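/- Let $\mathsf X$ be a state space with a countably generated $\sigma$-field $\mathcal B$, and let $P$ be a Markov transition kernel on $(\mathsf X,\mathcal B)$ whose chain is positive Harris recurrent and aperiodic; equivalently, there is an invariant probability measure $\pi$ (necessarily unique) such that $\|P^k(x,\cdot)-\pi\|\to 0$ in total variation as $k\to\infty$, for every $x\in\mathsf X$. For a positive kernel $K$ on $(\mathsf X,\mathcal B)$, a set $C\in\mathcal B$ is called *small for* $K$ if there are $\varepsilon>0$, $n\ge 1$ and a probability measure $\nu$ on $\mathcal B$ such that $K^n(x,A)\ge\varepsilon\,\nu(A)$ for all $x\in C$ and $A\in\mathcal B$. Assume (V3): there are measurable functions $V:\mathsf X\to[0,\infty]$ and $W:\mathsf X\to[1,\infty)$, a set $C_0$ that is small for $P$, and a constant $b<\infty$ such that $$PV\le V-W+b\,\mathbb 1_{C_0}\qquad\text{on }\{x: V(x)<\infty\}.$$ Let $F\in L_\infty^W$, that is, $F:\mathsf X\to\mathbb R$ is measurable and $\|F\|_W:=\sup_{x}|F(x)|/W(x)<\infty$. For $a\in\mathbb R$ let $P_a$ be the scaled kernel $P_a(x,A):=e^{aF(x)}P(x,A)$,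 and for $r\ge1$ let $C_V(r):=\{x\in\mathsf X: V(x)\le r\}$. **Proposition 2.5.** For every $r\ge 1$ and $a\in\mathbb R$ the set $C_V(r)$ is small for $P_a$. Moreover, for every $a_0>0$ and $r\ge1$ there exist $\varepsilon_0>0$, $n_0\ge1$ and a probability measure $\nu_0$ on $\mathcal B$ such that $$P_a^{n_0}(x,A)\ge\varepsilon_0\,\nu_0(A)\qquad\text{for all }x\in C_V(r),\ A\in\mathcal B,\ a\in[-a_0,a_0].$$ -/

import Mathlib

open MeasureTheory ProbabilityTheory Filter Topology
open scoped ENNReal NNReal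

namespace MarkovLDP

noncomputable section

/-- The iterates of a Markov kernel are Markov kernels. -/
instance instIsMarkovKernelPow {X : Type*} [MeasurableSpace X] (P : Kernel X X)
    [IsMarkovKernel P] (n : ℕ) : IsMarkovKernel (P ^ n) := by
  induction n with
  | zero =>
    rw [pow_zero]
    exact inferInstanceAs (IsMarkovKernel (Kernel.id : Kernel X X))
  | succ k ih =>
    rw [pow_succ]
    exact inferInstanceAs (IsMarkovKernel ((P ^ k) ∘ₖ P))

/-- The total-variation norm `‖μ - ν‖` of the difference of two finite measures: the total mass
of the total variation of the signed measure `μ - ν`. -/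
def tvNorm {X : Type*} [MeasurableSpace X] (μ ν : Measure X) [IsFiniteMeasure μ]
    [IsFiniteMeasure ν] : ℝ≥0∞ :=
  (μ.toSignedMeasure - ν.toSignedMeasure).totalVariation Set.univ

/-- The chain with transition kernel `P` is positive Harris recurrent and aperiodic: there is an
invariant probability measure `π` with `‖P^k(x, ·) - π‖ → 0` in total variation from *every*
initial state `x`. (Uniqueness of `π` follows from the convergence.) -/
def IsPositiveHarrisAperiodic {X : Type*} [MeasurableSpace X] (P : Kernel X X)
    [IsMarkovKernel P] : Prop :=
  ∃ (π : Measure X) (_ : IsProbabilityMeasure π), Kernel.Invariant P π ∧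
    ∀ x : X, Tendsto (fun k : ℕ => tvNorm ((P ^ k) x) π) atTop (𝓝 0)

/-- A measurable function `s : X → ℝ₊` and a probability measure `ν` are small for the positive
kernel `K` if `K^n(x, A) ≥ s(x) ν(A)` for some `n ≥ 1`, all `x` and all measurable `A`. -/
structure IsSmallPair {X : Type*} [MeasurableSpace X] (K : Kernel X X) (s : X → ℝ≥0)
    (ν : Measure X) : Prop where
  measurable : Measurable s
  isProbabilityMeasure : IsProbabilityMeasure ν
  minorization : ∃ n : ℕ, 1 ≤ n ∧
    ∀ (x : X) (A : Set X), MeasurableSet A → (s x : ℝ≥0∞) * ν A ≤ (K ^ n) x A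

/-- A measurable set `C` is small for the positive kernel `K` if `ε 1_C` is a small function for
some `ε > 0`. -/
def IsSmallSet {X : Type*} [MeasurableSpace X] (K : Kernel X X) (C : Set X) : Prop :=
  MeasurableSet C ∧ ∃ ε : ℝ≥0, 0 < ε ∧
    ∃ ν : Measure X, IsSmallPair K (C.indicator fun _ => ε) ν

/-- The drift condition (V3): `PV ≤ V - W + b 1_C` on `{V < ∞}`, where `V` takes values in
`[0, ∞]`, `W` takes values in `[1, ∞)`, `C` is a small set for `P` and `b < ∞`. The function `W`
is moved to the left-hand side, which changes nothing at points where `V` is finite. -/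
structure DriftV3 {X : Type*} [MeasurableSpace X] (P : Kernel X X)
    (V : X → ℝ≥0∞) (W : X → ℝ) (C : Set X) (b : ℝ≥0) : Prop where
  measurable_V : Measurable V
  measurable_W : Measurable W
  one_le_W : ∀ x, 1 ≤ W x
  small : IsSmallSet P C
  drift : ∀ x, V x < ∞ →
    ∫⁻ y, V y ∂(P x) + ENNReal.ofReal (W x) ≤ V x + C.indicator (fun _ => (b : ℝ≥0∞)) x

/-- The weighted space `L_∞^W`: measurable functions `h` with `sup_x |h(x)| / W(x) < ∞`. -/
def MemLinftyW {X : Type*} [MeasurableSpace X] (W : X → ℝ) (h : X → ℝ) : Prop :=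
  Measurable h ∧ BddAbove (Set.range fun x => |h x| / W x)

/-- The scaled kernel `P_h(x, dy) = h(x) P(x, dy)`, for a measurable `h : X → (0, ∞)`. -/
def scaledKernel {X : Type*} [MeasurableSpace X] (P : Kernel X X) [IsSFiniteKernel P]
    (h : X → ℝ) : Kernel X X :=
  P.withDensity fun x _ => ENNReal.ofReal (h x)

theorem scaledKernel_apply {X : Type*} [MeasurableSpace X] (P : Kernel X X) [IsSFiniteKernel P]
    {h : X → ℝ} (hh : Measurable h) (x : X) (A : Set X) :
    scaledKernel P h x A = ENNReal.ofReal (h x) * P x A := by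
  have hm : Measurable (Function.uncurry fun (x : X) (_ : X) => ENNReal.ofReal (h x)) :=
    (hh.comp measurable_fst).ennreal_ofReal
  rw [scaledKernel, Kernel.withDensity_apply' P hm, lintegral_const,
    Measure.restrict_apply_univ]

/-- The kernels `P_a`, that is, the scaled kernel `P_h` with `h = e^{aF}`. -/
def expScaledKernel {X : Type*} [MeasurableSpace X] (P : Kernel X X) [IsSFiniteKernel P]
    (F : X → ℝ) (a : ℝ) : Kernel X X :=
  scaledKernel P fun x => Real.exp (a * F x)

/-- The sublevel set `C_V(r) = {x : V(x) ≤ r}`. -/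
def sublevel {X : Type*} (V : X → ℝ≥0∞) (r : ℝ) : Set X :=
  {x | V x ≤ ENNReal.ofReal r}

end

end MarkovLDP

open MarkovLDP

/-! Write `Q` for `P_a`. From points with `W ≤ N`, `P ≤ c_N Q` with `c_N` uniform over `|a| ≤ a₀`,
so `P ^ n ≤ c_N ^ n Q ^ n + T`, where `T` collects the paths leaving `{W ≤ N}` before time `n`. The
summed drift inequality and Markov's inequality bound the mass of `T` by `(V x + b n) / N`.

Small mass alone does not transfer `P ^ m ≥ ε ν` to `Q`: `T` may beat `ε ν A` on sets `A` of small
`ν`-measure. But the `π`-average of `T` over `D = C ∩ {V ≤ r'}` is dominated by a multiple of `ν` on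
some `B` with `ν B ≠ 0`, so each `A ⊆ B` satisfies `Q ^ m y A ≥ γ ν A` for all `y` in a set of
`π`-mass at least `π D / 2` (`exists_forall_half_le_measure`). This set varies with `A`, yet `P`
reaches all sets of that mass at one time `L` with probability at least `δ`
(`DriftV3.exists_forall_le_pow_apply`), and truncation passes this on to `Q`. Composing the two
gives a minorization by `ν` conditioned on `B`. -/

namespace MarkovLDP

/-! ### Powers of kernels -/

section Powers

variable {X : Type*} [MeasurableSpace X]

theorem pow_zero_apply (K : Kernel X X) (x : X) : (K ^ 0) x = Measure.dirac x := by
  rw [pow_zero]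
  exact Kernel.id_apply x

theorem pow_add_apply' (K : Kernel X X) (m n : ℕ) (x : X) {A : Set X} (hA : MeasurableSet A) :
    (K ^ (m + n)) x A = ∫⁻ y, (K ^ m) y A ∂((K ^ n) x) := by
  rw [pow_add]
  exact Kernel.comp_apply' _ _ _ hA

theorem pow_succ_apply' (K : Kernel X X) (n : ℕ) (x : X) {A : Set X} (hA : MeasurableSet A) :
    (K ^ (n + 1)) x A = ∫⁻ y, (K ^ n) y A ∂(K x) := by
  rw [pow_add_apply' K n 1 x hA, pow_one]

theorem lintegral_pow_succ (K : Kernel X X) (n : ℕ) (x : X) {f : X → ℝ≥0∞} (hf : Measurable f) :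
    ∫⁻ z, f z ∂((K ^ (n + 1)) x) = ∫⁻ y, ∫⁻ z, f z ∂((K ^ n) y) ∂(K x) := by
  rw [pow_succ]
  exact Kernel.lintegral_comp _ _ _ hf

theorem lintegral_pow_eq_of_invariant {P : Kernel X X} {π : Measure X} (hπ : Kernel.Invariant P π)
    (n : ℕ) {A : Set X} (hA : MeasurableSet A) :
    ∫⁻ y, (P ^ n) y A ∂π = π A := by
  have h : Kernel.Invariant (P ^ n) π := by
    induction n with
    | zero =>
      rw [pow_zero]
      exact Measure.id_comp
    | succ n ih =>
      rw [pow_succ]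
      exact ih.comp hπ
  conv_rhs => rw [← h.def]
  rw [Measure.bind_apply hA (Kernel.aemeasurable _)]

end Powers

/-! ### Killing the chain outside a set -/

section Truncation

variable {X : Type*} [MeasurableSpace X]

open scoped Classical in
/-- The mass that `P ^ n` loses when the chain is killed on leaving `G`: at `(x, A)` this is the
probability that `X_n ∈ A` while `X_k ∉ G` for some `k < n`, started from `x`. -/
noncomputable def exitKernel (P : Kernel X X) {G : Set X} (hG : MeasurableSet G) : ℕ → Kernel X X
  | 0 => 0
  | n + 1 => Kernel.piecewise hG (exitKernel P hG n ∘ₖ P) (P ^ (n + 1))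

open scoped Classical in
theorem exitKernel_succ_of_mem (P : Kernel X X) {G : Set X} (hG : MeasurableSet G) (n : ℕ) {x : X}
    (hx : x ∈ G) {A : Set X} (hA : MeasurableSet A) :
    exitKernel P hG (n + 1) x A = ∫⁻ y, exitKernel P hG n y A ∂(P x) := by
  rw [exitKernel, Kernel.piecewise_apply', if_pos hx, Kernel.comp_apply' _ _ _ hA]

open scoped Classical in
theorem exitKernel_succ_of_notMem (P : Kernel X X) {G : Set X} (hG : MeasurableSet G) (n : ℕ)
    {x : X} (hx : x ∉ G) (A : Set X) :
    exitKernel P hG (n + 1) x A = (P ^ (n + 1)) x A := by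
  rw [exitKernel, Kernel.piecewise_apply', if_neg hx]

/-- Each step taken from `G` costs a factor `c`; off `G` the exit term already contains all of `P ^
n`. -/
theorem pow_le_mul_pow_add_exitKernel (P Q : Kernel X X) {G : Set X} (hG : MeasurableSet G)
    (c : ℝ≥0∞) (hPQ : ∀ x ∈ G, P x ≤ c • Q x) (n : ℕ) (x : X) {A : Set X}
    (hA : MeasurableSet A) :
    (P ^ n) x A ≤ c ^ n * (Q ^ n) x A + exitKernel P hG n x A := by
  induction n generalizing x with
  | zero => simp [exitKernel]
  | succ n ih =>
    by_cases hx : x ∈ G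
    · rw [exitKernel_succ_of_mem P hG n hx hA, pow_succ_apply' _ _ _ hA, pow_succ_apply' _ _ _ hA]
      calc ∫⁻ y, (P ^ n) y A ∂(P x)
          ≤ ∫⁻ y, (c ^ n * (Q ^ n) y A + exitKernel P hG n y A) ∂(P x) :=
            lintegral_mono fun y => ih y
        _ = c ^ n * ∫⁻ y, (Q ^ n) y A ∂(P x) + ∫⁻ y, exitKernel P hG n y A ∂(P x) := by
            rw [lintegral_add_right _ (Kernel.measurable_coe _ hA),
              lintegral_const_mul _ (Kernel.measurable_coe _ hA)]
        _ ≤ c ^ n * ∫⁻ y, (Q ^ n) y A ∂(c • Q x) + ∫⁻ y, exitKernel P hG n y A ∂(P x) := by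
            gcongr
            exact hPQ x hx
        _ = _ := by
            rw [lintegral_smul_measure, smul_eq_mul, pow_succ, mul_assoc]
    · rw [exitKernel_succ_of_notMem P hG n hx]
      exact le_add_self

/-- Union bound over the times `k < n` spent outside `G`. -/
theorem exitKernel_univ_le (P : Kernel X X) [IsMarkovKernel P] {G : Set X}
    (hG : MeasurableSet G) (n : ℕ) (x : X) :
    exitKernel P hG n x Set.univ ≤ ∑ k ∈ Finset.range n, (P ^ k) x Gᶜ := by
  induction n generalizing x with
  | zero => simp [exitKernel]
  | succ n ih =>
    rw [Finset.sum_range_succ', pow_zero_apply, Measure.dirac_apply' _ hG.compl]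
    by_cases hx : x ∈ G
    · rw [exitKernel_succ_of_mem P hG n hx .univ]
      refine le_add_right ?_
      calc ∫⁻ y, exitKernel P hG n y Set.univ ∂(P x)
          ≤ ∫⁻ y, ∑ k ∈ Finset.range n, (P ^ k) y Gᶜ ∂(P x) := lintegral_mono fun y => ih y
        _ = ∑ k ∈ Finset.range n, (P ^ (k + 1)) x Gᶜ := by
          rw [lintegral_finsetSum _ fun k _ => Kernel.measurable_coe _ hG.compl]
          exact Finset.sum_congr rfl fun k _ => (pow_succ_apply' _ _ _ hG.compl).symm
    · simp [exitKernel_succ_of_notMem P hG n hx, hx]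

end Truncation

/-! ### Consequences of the drift condition -/

section Drift

variable {X : Type*} [MeasurableSpace X] {P : Kernel X X} {V : X → ℝ≥0∞} {W : X → ℝ}
  {C : Set X} {b : ℝ≥0}

theorem DriftV3.lintegral_pow_add_sum_le (h : DriftV3 P V W C b) (n : ℕ) (x : X)
    (hx : V x < ∞) :
    ∫⁻ y, V y ∂((P ^ n) x) +
        ∑ k ∈ Finset.range n, ∫⁻ y, ENNReal.ofReal (W y) ∂((P ^ k) x) ≤
      V x + b * ∑ k ∈ Finset.range n, (P ^ k) x C := by
  have hV := h.measurable_V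
  have hw : Measurable fun y => ENNReal.ofReal (W y) := h.measurable_W.ennreal_ofReal
  have hC := h.small.1
  induction n generalizing x with
  | zero =>
    rw [pow_zero_apply, lintegral_dirac' _ hV]
    simp
  | succ n ih =>
    -- Finiteness of `PV` at `x` makes `V` finite at almost every next state, where the induction
    -- hypothesis applies.
    have hfin : ∫⁻ y, V y ∂(P x) ≠ ∞ := by
      refine ne_top_of_le_ne_top ?_ (le_self_add.trans (h.drift x hx))
      by_cases hxC : x ∈ C <;> simp [hxC, hx.ne]
    have hae : ∀ᵐ y ∂(P x), V y < ∞ := ae_lt_top hV hfin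
    have key : ∫⁻ y, V y ∂((P ^ (n + 1)) x) +
        ∑ k ∈ Finset.range n, ∫⁻ y, ENNReal.ofReal (W y) ∂((P ^ (k + 1)) x) ≤
        ∫⁻ y, V y ∂(P x) + b * ∑ k ∈ Finset.range n, (P ^ (k + 1)) x C := by
      have e1 : ∀ k, Measurable fun y => ∫⁻ z, ENNReal.ofReal (W z) ∂((P ^ k) y) :=
        fun k => hw.lintegral_kernel
      have e2 : ∀ k, Measurable fun y => (P ^ k) y C := fun k => Kernel.measurable_coe _ hC
      simp_rw [lintegral_pow_succ P _ x hV, lintegral_pow_succ P _ x hw,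
        pow_succ_apply' P _ x hC]
      rw [← lintegral_finsetSum _ fun k _ => e1 k, ← lintegral_finsetSum _ fun k _ => e2 k,
        ← lintegral_add_right _ (Finset.measurable_fun_sum _ fun k _ => e1 k),
        ← lintegral_const_mul _ (Finset.measurable_fun_sum _ fun k _ => e2 k),
        ← lintegral_add_left hV]
      exact lintegral_mono_ae (hae.mono fun y hy => ih y hy)
    rw [Finset.sum_range_succ', Finset.sum_range_succ', pow_zero_apply, lintegral_dirac' _ hw,
      Measure.dirac_apply' _ hC, ← add_assoc]
    calc _ ≤ ∫⁻ y, V y ∂(P x) + b * ∑ k ∈ Finset.range n, (P ^ (k + 1)) x C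
          + ENNReal.ofReal (W x) := by gcongr
      _ = (∫⁻ y, V y ∂(P x) + ENNReal.ofReal (W x))
          + b * ∑ k ∈ Finset.range n, (P ^ (k + 1)) x C := by ring
      _ ≤ (V x + C.indicator (fun _ => (b : ℝ≥0∞)) x)
          + b * ∑ k ∈ Finset.range n, (P ^ (k + 1)) x C := by
        exact add_le_add_left (h.drift x hx) _
      _ = _ := by
        have : C.indicator (fun _ => (b : ℝ≥0∞)) x = b * C.indicator 1 x := by
          by_cases hxC : x ∈ C <;> simp [hxC]
        rw [this]
        ring

variable [IsMarkovKernel P]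

theorem DriftV3.natCast_le (h : DriftV3 P V W C b) (n : ℕ) (x : X) (hx : V x < ∞) :
    (n : ℝ≥0∞) ≤ V x + b * ∑ k ∈ Finset.range n, (P ^ k) x C := by
  refine le_trans ?_ (le_add_self.trans (h.lintegral_pow_add_sum_le n x hx))
  calc (n : ℝ≥0∞) = ∑ k ∈ Finset.range n, ∫⁻ _, 1 ∂((P ^ k) x) := by simp
    _ ≤ _ := Finset.sum_le_sum fun k _ => lintegral_mono fun y => by
      simpa using ENNReal.ofReal_le_ofReal (h.one_le_W y)

theorem DriftV3.sum_pow_le (h : DriftV3 P V W C b) (n : ℕ) (x : X) (hx : V x < ∞) :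
    ∑ k ∈ Finset.range n, ∫⁻ y, ENNReal.ofReal (W y) ∂((P ^ k) x) ≤ V x + b * n := by
  refine (le_add_self.trans (h.lintegral_pow_add_sum_le n x hx)).trans ?_
  gcongr
  calc ∑ k ∈ Finset.range n, (P ^ k) x C ≤ ∑ k ∈ Finset.range n, 1 :=
        Finset.sum_le_sum fun k _ => prob_le_one
    _ = n := by simp

theorem DriftV3.pow_apply_eq_top (h : DriftV3 P V W C b) (n : ℕ) (x : X) (hx : V x < ∞) :
    (P ^ n) x {y | V y = ∞} = 0 := by
  have hfin : ∫⁻ y, V y ∂((P ^ n) x) ≠ ∞ := by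
    refine ne_top_of_le_ne_top ?_ (le_self_add.trans (h.lintegral_pow_add_sum_le n x hx))
    refine ENNReal.add_ne_top.2 ⟨hx.ne, ENNReal.mul_ne_top ENNReal.coe_ne_top ?_⟩
    exact ENNReal.sum_ne_top.2 fun k _ => measure_ne_top _ _
  have := ae_lt_top h.measurable_V hfin
  simpa [ae_iff] using this

theorem measurableSet_le_natCast (hW : Measurable W) (N : ℕ) : MeasurableSet {x | W x ≤ N} :=
  measurableSet_le hW measurable_const

/-- Markov's inequality for `W` at level `N`, at each time before `n`. -/
theorem DriftV3.natCast_mul_exitKernel_univ_le (h : DriftV3 P V W C b) (N n : ℕ) (x : X)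
    (hx : V x < ∞) :
    N * exitKernel P (measurableSet_le_natCast h.measurable_W N) n x Set.univ ≤ V x + b * n := by
  refine le_trans ?_ (h.sum_pow_le n x hx)
  refine (mul_le_mul_right (exitKernel_univ_le P _ n x) _).trans ?_
  rw [Finset.mul_sum]
  refine Finset.sum_le_sum fun k _ => ?_
  refine le_trans ?_ (mul_meas_ge_le_lintegral h.measurable_W.ennreal_ofReal (N : ℝ≥0∞))
  gcongr
  intro y hy
  have hy' : (N : ℝ) < W y := not_le.1 hy
  simpa using ENNReal.ofReal_le_ofReal hy'.le

/-- Killing at a high enough level of `W` loses little mass, uniformly on sublevel sets of `V`. -/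
theorem DriftV3.exists_exitKernel_univ_le (h : DriftV3 P V W C b) (n : ℕ) {r ζ : ℝ≥0∞}
    (hr : r < ∞) (hζ : ζ ≠ 0) :
    ∃ N : ℕ, ∀ x, V x ≤ r →
      exitKernel P (measurableSet_le_natCast h.measurable_W N) n x Set.univ ≤ ζ := by
  obtain ⟨N, hN⟩ := ENNReal.exists_nat_mul_gt hζ
    (ENNReal.add_ne_top.2 ⟨hr.ne, ENNReal.mul_ne_top (ENNReal.coe_ne_top (r := b))
      (ENNReal.natCast_ne_top n)⟩)
  refine ⟨N, fun x hx => ?_⟩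
  have h1 := h.natCast_mul_exitKernel_univ_le N n x (hx.trans_lt hr)
  have h2 : V x + b * n ≤ r + b * n := by gcongr
  exact (lt_of_mul_lt_mul_left' ((h1.trans h2).trans_lt hN)).le

end Drift

/-! ### Total-variation convergence, uniformly over sets -/

section TotalVariation

variable {X : Type*} [MeasurableSpace X]

theorem measure_le_add_tvNorm (μ ν : Measure X) [IsFiniteMeasure μ] [IsFiniteMeasure ν]
    {A : Set X} (hA : MeasurableSet A) : ν A ≤ μ A + tvNorm μ ν := by
  set s := μ.toSignedMeasure - ν.toSignedMeasure with hs
  have h1 := s.apply_eq_posPart_real_sub_negPart_real hA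
  have h2 : s A = μ.real A - ν.real A := by
    simp [hs, Measure.toSignedMeasure_apply_measurable hA]
  have h3 : ν.real A ≤ μ.real A + s.toJordanDecomposition.negPart.real A := by
    have := measureReal_nonneg (μ := s.toJordanDecomposition.posPart) (s := A)
    linarith
  have h4 : ν A ≤ μ A + s.toJordanDecomposition.negPart A := by
    have := ENNReal.ofReal_le_ofReal h3
    rwa [ENNReal.ofReal_add measureReal_nonneg measureReal_nonneg, ofReal_measureReal,
      ofReal_measureReal, ofReal_measureReal] at this
  refine h4.trans ?_
  gcongr
  rw [tvNorm, ← hs, SignedMeasure.totalVariation, Measure.add_apply]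
  exact (measure_mono (Set.subset_univ A)).trans le_add_self

/-- Convergence in total variation from every point gives, from every initial distribution, a
lower bound that is uniform over the sets of stationary mass at least `t`. -/
theorem exists_forall_le_lintegral_pow {P : Kernel X X} [IsMarkovKernel P] {π : Measure X}
    [IsProbabilityMeasure π]
    (hconv : ∀ x : X, Tendsto (fun k : ℕ => tvNorm ((P ^ k) x) π) atTop (𝓝 0))
    (ν : Measure X) [IsProbabilityMeasure ν] {s t : ℝ≥0∞} (hst : s < t) :
    ∃ k₀ : ℕ, ∀ k, k₀ ≤ k → ∀ A, MeasurableSet A → t ≤ π A → s ≤ ∫⁻ z, (P ^ k) z A ∂ν := by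
  -- Otherwise some times `k i ≥ i` and sets `A i` violate the bound; pointwise convergence along
  -- `k` then contradicts Fatou's lemma. Measurability of the total-variation distance in `z` is
  -- never needed.
  by_contra! H
  choose k hk A hA htA hlt using H
  obtain ⟨s', hs', hs't⟩ := exists_between hst
  have hpt : ∀ z, s' ≤ liminf (fun i => (P ^ k i) z (A i)) atTop := by
    intro z
    have hk' : Tendsto k atTop atTop := tendsto_atTop_mono hk tendsto_id
    have hev := ((hconv z).comp hk').eventually (gt_mem_nhds (tsub_pos_of_lt hs't))
    refine le_liminf_of_le (by isBoundedDefault) (hev.mono fun i hi => ?_)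
    have h1 := (htA i).trans (measure_le_add_tvNorm ((P ^ k i) z) π (hA i))
    by_contra! hc
    have h2 : (P ^ k i) z (A i) + tvNorm ((P ^ k i) z) π < s' + (t - s') :=
      ENNReal.add_lt_add hc hi
    rw [add_tsub_cancel_of_le hs't.le] at h2
    exact absurd h1 (not_le.2 h2)
  have h1 : s' ≤ ∫⁻ z, liminf (fun i => (P ^ k i) z (A i)) atTop ∂ν := by
    simpa using lintegral_mono (μ := ν) hpt
  have h2 := h1.trans (lintegral_liminf_le fun i => Kernel.measurable_coe (P ^ k i) (hA i))
  have h3 : liminf (fun i => ∫⁻ z, (P ^ k i) z (A i) ∂ν) atTop ≤ s :=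
    liminf_le_of_le (by isBoundedDefault) fun c hc => by
      obtain ⟨i, hi⟩ := hc.exists
      exact hi.trans (hlt i).le
  exact absurd (h2.trans h3) (not_le.2 hs')

end TotalVariation

/-! ### Domination of a kernel of small mass by `ν` -/

section WeakMinorization

variable {X : Type*} [MeasurableSpace X]

/-- `B` is the Hahn set where `c • ν` dominates; were it `ν`-null, its complement would force `c ≤
lam univ`. -/
theorem exists_forall_subset_le_mul (ν lam : Measure X) [IsProbabilityMeasure ν] {c : ℝ≥0∞}
    (hc : c ≠ ∞) (hlam : lam Set.univ < c) :
    ∃ B, MeasurableSet B ∧ ν B ≠ 0 ∧ ∀ A, MeasurableSet A → A ⊆ B → lam A ≤ c * ν A := by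
  have : IsFiniteMeasure lam := ⟨hlam.trans_le le_top⟩
  have : IsFiniteMeasure (c • ν) := ν.smul_finite hc
  obtain ⟨B, hB, h1, h2⟩ := hahn_decomposition (c • ν) lam
  refine ⟨B, hB, fun h0 => ?_, fun A hA hAB => by simpa using h1 A hA hAB⟩
  have h3 := h2 Bᶜ hB.compl subset_rfl
  rw [Measure.smul_apply, smul_eq_mul, (prob_compl_eq_one_iff hB).2 h0, mul_one] at h3
  exact absurd (h3.trans (measure_mono (Set.subset_univ _))) (not_le.2 hlam)

/-- A kernel `T` of small mass on `D` is, on a suitable set `B` that `ν` charges, dominated by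
`ν` from half of the points of `D`; the half may depend on the subset of `B`. -/
theorem exists_forall_half_le_measure (π ν : Measure X) [IsProbabilityMeasure π]
    [IsProbabilityMeasure ν] (T : Kernel X X) {D : Set X} (hD : MeasurableSet D) (hπD : π D ≠ 0)
    {ε : ℝ≥0} (hε : 0 < ε) (hT : ∀ y ∈ D, T y Set.univ ≤ (ε : ℝ≥0∞) / 8) :
    ∃ B, MeasurableSet B ∧ ν B ≠ 0 ∧ ∀ A, MeasurableSet A → A ⊆ B → ν A ≠ 0 →
      π D / 2 ≤ π {y | y ∈ D ∧ T y A ≤ (ε : ℝ≥0∞) / 2 * ν A} := by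
  have hε' : (ε : ℝ≥0∞) ≠ 0 := by simpa using hε.ne'
  have hbind : ∀ A, MeasurableSet A → (π.restrict D).bind T A = ∫⁻ y in D, T y A ∂π :=
    fun A hA => Measure.bind_apply hA (Kernel.aemeasurable _)
  have hmass : (π.restrict D).bind T Set.univ < ε / 4 * π D := by
    rw [hbind _ .univ]
    calc ∫⁻ y in D, T y Set.univ ∂π ≤ ∫⁻ _ in D, (ε : ℝ≥0∞) / 8 ∂π :=
          setLIntegral_mono' hD hT
      _ = ε / 8 * π D := by simp
      _ < ε / 4 * π D := by
        refine ENNReal.mul_lt_mul_left hπD (measure_ne_top _ _) ?_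
        exact ENNReal.div_lt_div_left hε' ENNReal.coe_ne_top (by norm_num)
  have hc : (ε : ℝ≥0∞) / 4 * π D ≠ ∞ :=
    ENNReal.mul_ne_top (ENNReal.div_ne_top ENNReal.coe_ne_top (by norm_num)) (measure_ne_top _ _)
  obtain ⟨B, hB, hνB, hdom⟩ := exists_forall_subset_le_mul ν _ hc hmass
  refine ⟨B, hB, hνB, fun A hA hAB hνA => ?_⟩
  set S := {y | (ε : ℝ≥0∞) / 2 * ν A ≤ T y A} with hS
  have hSm : MeasurableSet S := measurableSet_le measurable_const (Kernel.measurable_coe _ hA)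
  -- Markov's inequality: the integral of `T · A` over `D` is at most `ε / 4 * π D * ν A`.
  -- Cancelling `ν A` is what requires it to be nonzero.
  have hSD : π (S ∩ D) ≤ π D / 2 := by
    have h1 : (ε : ℝ≥0∞) / 2 * ν A * π (S ∩ D) ≤ ε / 2 * ν A * (π D / 2) := by
      calc (ε : ℝ≥0∞) / 2 * ν A * π (S ∩ D) ≤ ∫⁻ y in D, T y A ∂π := by
            rw [← Measure.restrict_apply hSm]
            exact mul_meas_ge_le_lintegral (Kernel.measurable_coe _ hA) _
        _ ≤ ε / 4 * π D * ν A := by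
            rw [← hbind A hA]
            exact hdom A hA hAB
        _ = ε / 2 * ν A * (π D / 2) := by
            have : (4 : ℝ≥0∞)⁻¹ = 2⁻¹ * 2⁻¹ := by
              rw [← ENNReal.mul_inv (by norm_num) (by norm_num)]
              norm_num
            simp only [div_eq_mul_inv, this]
            ring
    refine (ENNReal.mul_le_mul_iff_right ?_ ?_).1 h1
    · exact mul_ne_zero (ENNReal.div_ne_zero.2 ⟨hε', by norm_num⟩) hνA
    · exact ENNReal.mul_ne_top (ENNReal.div_ne_top ENNReal.coe_ne_top (by norm_num))
        (measure_ne_top _ _)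
  have hsplit : π D ≤ π (S ∩ D) + π {y | y ∈ D ∧ T y A ≤ (ε : ℝ≥0∞) / 2 * ν A} := by
    refine (measure_mono fun y hy => ?_).trans (measure_union_le _ _)
    rcases le_total ((ε : ℝ≥0∞) / 2 * ν A) (T y A) with h | h
    · exact Or.inl ⟨h, hy⟩
    · exact Or.inr ⟨hy, h⟩
  refine (ENNReal.add_le_add_iff_left
    (ENNReal.div_ne_top (measure_ne_top π D) two_ne_zero)).1 ?_
  rw [ENNReal.add_halves]
  exact hsplit.trans (by gcongr)

end WeakMinorization

/-! ### Reaching large sets, and the minorization -/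

section Stationary

variable {X : Type*} [MeasurableSpace X] {P : Kernel X X} [IsMarkovKernel P] {V : X → ℝ≥0∞}
  {W : X → ℝ} {C : Set X} {b : ℝ≥0} {π : Measure X} [IsProbabilityMeasure π]

theorem DriftV3.measure_eq_top_eq_zero (h : DriftV3 P V W C b)
    (hconv : ∀ x : X, Tendsto (fun k : ℕ => tvNorm ((P ^ k) x) π) atTop (𝓝 0))
    {x : X} (hx : V x < ∞) : π {y | V y = ∞} = 0 := by
  refine le_antisymm (ge_of_tendsto' (hconv x) fun k => ?_) zero_le
  have := measure_le_add_tvNorm ((P ^ k) x) π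
    (h.measurable_V (measurableSet_singleton ∞) : MeasurableSet {y | V y = ∞})
  have h0 : ((P ^ k) x) (V ⁻¹' {∞}) = 0 := h.pow_apply_eq_top k x hx
  rwa [h0, zero_add] at this

/-- If `π C = 0`, then from `π`-almost every `y` the chain almost surely avoids `C`, and the summed
drift gives `n ≤ V y` for all `n`. -/
theorem DriftV3.measure_ne_zero (h : DriftV3 P V W C b) (hπ : Kernel.Invariant P π)
    (hV : π {y | V y = ∞} = 0) : π C ≠ 0 := by
  intro h0
  have hC := h.small.1
  have hae : ∀ᵐ y ∂π, ∀ k : ℕ, (P ^ k) y C = 0 := by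
    rw [ae_all_iff]
    intro k
    have := lintegral_pow_eq_of_invariant hπ k hC
    rw [h0, lintegral_eq_zero_iff (Kernel.measurable_coe _ hC)] at this
    exact this
  have hfin : ∀ᵐ y ∂π, V y < ∞ := by simpa [ae_iff] using hV
  obtain ⟨y, hy0, hy⟩ := (hae.and hfin).exists
  obtain ⟨n, hn⟩ := ENNReal.exists_nat_gt hy.ne
  have := h.natCast_le n y hy
  simp only [hy0, Finset.sum_const_zero, mul_zero, add_zero] at this
  exact absurd this (not_le.2 hn)

theorem DriftV3.exists_measure_inter_ne_zero (h : DriftV3 P V W C b)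
    (hπ : Kernel.Invariant P π) (hV : π {y | V y = ∞} = 0) :
    ∃ r : ℕ, π (C ∩ {y | V y ≤ r}) ≠ 0 := by
  by_contra! H
  refine h.measure_ne_zero hπ hV (measure_mono_null (t := (⋃ r : ℕ, C ∩ {y | V y ≤ r}) ∪
    {y | V y = ∞}) (fun y hy => ?_) (measure_union_null (measure_iUnion_null H) hV))
  by_cases hy' : V y = ∞
  · exact Or.inr hy'
  · obtain ⟨n, hn⟩ := ENNReal.exists_nat_gt hy'
    exact Or.inl (Set.mem_iUnion.2 ⟨n, hy, hn.le⟩)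

/-- From a sublevel set of `V` the chain reaches `C`, within a bounded number of steps and with
probability bounded below. -/
theorem DriftV3.exists_pow_apply_ge (h : DriftV3 P V W C b) {r : ℝ≥0∞} (hr : r < ∞) :
    ∃ (n : ℕ) (η : ℝ≥0∞), η ≠ 0 ∧ ∀ x, V x ≤ r → ∃ j < n, η ≤ (P ^ j) x C := by
  -- With `n > r + 1`, the bound `n ≤ V x + b ∑ P ^ k x C` forces the last term above `1`, so some
  -- summand is at least `1 / (b n + 1)`.
  obtain ⟨n, hn⟩ := ENNReal.exists_nat_gt (ENNReal.add_ne_top.2 ⟨hr.ne, ENNReal.one_ne_top⟩)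
  have hbn : (b : ℝ≥0∞) * n ≠ ∞ := ENNReal.mul_ne_top ENNReal.coe_ne_top (ENNReal.natCast_ne_top n)
  refine ⟨n, (b * n + 1)⁻¹, ENNReal.inv_ne_zero.2 (ENNReal.add_ne_top.2
    ⟨hbn, ENNReal.one_ne_top⟩), fun x hx => ?_⟩
  by_contra! H
  have h1 := h.natCast_le n x (hx.trans_lt hr)
  have h2 : b * ∑ k ∈ Finset.range n, (P ^ k) x C ≤ 1 := by
    calc b * ∑ k ∈ Finset.range n, (P ^ k) x C
        ≤ b * ∑ k ∈ Finset.range n, ((b : ℝ≥0∞) * n + 1)⁻¹ := by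
          gcongr with k hk
          exact (H k (Finset.mem_range.1 hk)).le
      _ = (b * n) * ((b : ℝ≥0∞) * n + 1)⁻¹ := by simp [mul_assoc]
      _ ≤ (b * n + 1) * ((b : ℝ≥0∞) * n + 1)⁻¹ := by gcongr; exact le_self_add
      _ ≤ 1 := ENNReal.mul_inv_le_one _
  exact absurd (h1.trans (add_le_add hx h2)) (not_le.2 hn)

/-- From a sublevel set of `V`, all sets of stationary mass at least `t` are reached at one common
time with probability bounded below. -/
theorem DriftV3.exists_forall_le_pow_apply (h : DriftV3 P V W C b)
    (hconv : ∀ x : X, Tendsto (fun k : ℕ => tvNorm ((P ^ k) x) π) atTop (𝓝 0))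
    {r t : ℝ≥0∞} (hr : r < ∞) (ht : t ≠ 0) :
    ∃ (L : ℕ) (δ : ℝ≥0∞), δ ≠ 0 ∧ ∀ x, V x ≤ r → ∀ A, MeasurableSet A → t ≤ π A →
      δ ≤ (P ^ L) x A := by
  obtain ⟨hC, ε, hε, ν, -, hν, m, -, hm⟩ := h.small
  obtain ⟨n, η, hη, hn⟩ := h.exists_pow_apply_ge hr
  obtain ⟨s, hs0, hst⟩ := exists_between (pos_iff_ne_zero.2 ht)
  obtain ⟨k₀, hk₀⟩ := exists_forall_le_lintegral_pow hconv ν hst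
  -- The time `j` of reaching `C` depends on `x`; `n - j` extra steps after the minorization make
  -- the total time common, as `hk₀` holds for every `k ≥ k₀`.
  refine ⟨k₀ + m + n, ε * s * η, mul_ne_zero (mul_ne_zero (by simpa using hε.ne') hs0.ne') hη,
    fun x hx A hA htA => ?_⟩
  obtain ⟨j, hj, hηj⟩ := hn x hx
  have hC' : ∀ y ∈ C, ε * s ≤ (P ^ (k₀ + (n - j) + m)) y A := by
    intro y hy
    have hle : (ε : ℝ≥0∞) • ν ≤ (P ^ m) y :=
      Measure.le_iff.2 fun B hB => by simpa [hy] using hm y B hB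
    rw [pow_add_apply' _ _ _ _ hA]
    calc ε * s ≤ ε * ∫⁻ z, (P ^ (k₀ + (n - j))) z A ∂ν := by
          gcongr
          exact hk₀ _ le_self_add A hA htA
      _ = ∫⁻ z, (P ^ (k₀ + (n - j))) z A ∂((ε : ℝ≥0∞) • ν) := by
          rw [lintegral_smul_measure, smul_eq_mul]
      _ ≤ _ := lintegral_mono' hle le_rfl
  rw [show k₀ + m + n = k₀ + (n - j) + m + j by omega, pow_add_apply' _ _ _ _ hA]
  calc ε * s * η ≤ ε * s * (P ^ j) x C := by gcongr
    _ = ∫⁻ _ in C, ε * s ∂((P ^ j) x) := by simp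
    _ ≤ ∫⁻ y in C, (P ^ (k₀ + (n - j) + m)) y A ∂((P ^ j) x) := setLIntegral_mono' hC hC'
    _ ≤ _ := setLIntegral_le_lintegral _ _

/-- Kernels comparable to `P` on the sublevel sets of `W` satisfy, on a sublevel set of `V`, a
minorization condition whose constants depend only on the comparison constants. -/
theorem DriftV3.exists_minorization (h : DriftV3 P V W C b) (hπ : Kernel.Invariant P π)
    (hconv : ∀ x : X, Tendsto (fun k : ℕ => tvNorm ((P ^ k) x) π) atTop (𝓝 0))
    (c : ℕ → ℝ≥0) {r : ℝ≥0∞} (hr : r < ∞) (hne : ∃ x, V x ≤ r) :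
    ∃ (ε₀ : ℝ≥0∞) (n₀ : ℕ) (ν₀ : Measure X), ε₀ ≠ 0 ∧ 1 ≤ n₀ ∧ IsProbabilityMeasure ν₀ ∧
      ∀ Q : Kernel X X, (∀ (N : ℕ) (x : X), W x ≤ N → P x ≤ (c N : ℝ≥0∞) • Q x) →
        ∀ x, V x ≤ r → ∀ A, MeasurableSet A → ε₀ * ν₀ A ≤ (Q ^ n₀) x A := by
  obtain ⟨x₀, hx₀⟩ := hne
  have hV0 := h.measure_eq_top_eq_zero hconv (hx₀.trans_lt hr)
  obtain ⟨hC, ε, hε, ν, -, hν, m, hm1, hm⟩ := h.small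
  have hε' : (ε : ℝ≥0∞) ≠ 0 := by simpa using hε.ne'
  obtain ⟨r', hr'⟩ := h.exists_measure_inter_ne_zero hπ hV0
  set D := C ∩ {y | V y ≤ r'} with hD
  have hDm : MeasurableSet D := hC.inter (measurableSet_le h.measurable_V measurable_const)
  obtain ⟨N₁, hN₁⟩ := h.exists_exitKernel_univ_le m (ENNReal.natCast_lt_top r')
    (ENNReal.div_ne_zero.2 ⟨hε', by norm_num⟩ : (ε : ℝ≥0∞) / 8 ≠ 0)
  obtain ⟨B, hB, hνB, hhalf⟩ := exists_forall_half_le_measure π ν _ hDm hr' hε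
    fun y hy => hN₁ y hy.2
  have ht : π D / 2 ≠ 0 := ENNReal.div_ne_zero.2 ⟨hr', by norm_num⟩
  obtain ⟨L, δ, hδ, hL⟩ := h.exists_forall_le_pow_apply hconv hr ht
  -- The margin `δ - δ'` absorbs the mass lost by truncating at time `L`.
  obtain ⟨δ', hδ'0, hδ'⟩ := exists_between (pos_iff_ne_zero.2 hδ)
  have hδt : δ ≠ ∞ := ne_top_of_le_ne_top (measure_ne_top ((P ^ L) x₀) Set.univ)
    (hL x₀ hx₀ _ .univ (ENNReal.half_le_self.trans (measure_mono (Set.subset_univ D))))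
  obtain ⟨N₂, hN₂⟩ := h.exists_exitKernel_univ_le L hr (tsub_pos_of_lt hδ').ne'
  -- Adding `1` keeps the comparison constants nonzero, so that they can be inverted.
  set c₁ : ℝ≥0∞ := ((c N₁ + 1 : ℝ≥0) : ℝ≥0∞) ^ m with hc₁
  set c₂ : ℝ≥0∞ := ((c N₂ + 1 : ℝ≥0) : ℝ≥0∞) ^ L with hc₂
  have hc₁0 : c₁ ≠ 0 := pow_ne_zero _ (by simp)
  have hc₂0 : c₂ ≠ 0 := pow_ne_zero _ (by simp)
  have hc₁t : c₁ ≠ ∞ := ENNReal.pow_ne_top ENNReal.coe_ne_top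
  have hc₂t : c₂ ≠ ∞ := ENNReal.pow_ne_top ENNReal.coe_ne_top
  set γ : ℝ≥0∞ := c₁⁻¹ * (ε / 2) with hγ
  have hγ0 : γ ≠ 0 := mul_ne_zero (ENNReal.inv_ne_zero.2 hc₁t)
    (ENNReal.div_ne_zero.2 ⟨hε', by norm_num⟩)
  refine ⟨γ * ν B * (c₂⁻¹ * δ'), m + L, ProbabilityTheory.cond ν B,
    mul_ne_zero (mul_ne_zero hγ0 hνB) (mul_ne_zero (ENNReal.inv_ne_zero.2 hc₂t) hδ'0.ne'),
    by omega, cond_isProbabilityMeasure hνB, fun Q hQ x hx A hA => ?_⟩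
  have hQ' : ∀ (N : ℕ), ∀ x ∈ {x | W x ≤ N}, P x ≤ ((c N + 1 : ℝ≥0) : ℝ≥0∞) • Q x := by
    intro N x hx
    refine (hQ N x hx).trans (Measure.le_iff.2 fun S _ => ?_)
    simp only [Measure.smul_apply, smul_eq_mul]
    gcongr
    exact le_self_add
  set E := {y | γ * ν (B ∩ A) ≤ (Q ^ m) y A} with hE
  have hEm : MeasurableSet E := measurableSet_le measurable_const (Kernel.measurable_coe _ hA)
  have hπE : π D / 2 ≤ π E := by
    by_cases h0 : ν (B ∩ A) = 0
    · have : E = Set.univ := by simp [hE, h0]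
      rw [this, measure_univ]
      exact ENNReal.half_le_self.trans prob_le_one
    refine (hhalf (B ∩ A) (hB.inter hA) Set.inter_subset_left h0).trans (measure_mono ?_)
    rintro y ⟨hyD, hy⟩
    have h1 := pow_le_mul_pow_add_exitKernel P Q (measurableSet_le_natCast h.measurable_W N₁) _
      (hQ' N₁) m y (hB.inter hA)
    have h2 : (ε : ℝ≥0∞) * ν (B ∩ A) ≤ (P ^ m) y (B ∩ A) := by
      simpa [hyD.1] using hm y _ (hB.inter hA)
    -- The exit term uses at most half of `ε * ν (B ∩ A)`; the other half is left for `Q`.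
    have h3 : (ε : ℝ≥0∞) / 2 * ν (B ∩ A) ≤ c₁ * (Q ^ m) y A := by
      refine (ENNReal.add_le_add_iff_right (a := (ε : ℝ≥0∞) / 2 * ν (B ∩ A))
        (ENNReal.mul_ne_top (ENNReal.div_ne_top ENNReal.coe_ne_top two_ne_zero)
          (measure_ne_top _ _))).1 ?_
      rw [← add_mul, ENNReal.add_halves]
      refine (h2.trans h1).trans (add_le_add ?_ hy)
      gcongr
      exact Set.inter_subset_right
    show γ * ν (B ∩ A) ≤ (Q ^ m) y A
    rw [hγ, mul_assoc]
    exact (ENNReal.inv_mul_le_iff hc₁0 hc₁t).2 h3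
  have hQE : c₂⁻¹ * δ' ≤ (Q ^ L) x E := by
    rw [ENNReal.inv_mul_le_iff hc₂0 hc₂t]
    have h1 := pow_le_mul_pow_add_exitKernel P Q (measurableSet_le_natCast h.measurable_W N₂) _
      (hQ' N₂) L x hEm
    have h2 := (hL x hx E hEm hπE).trans (h1.trans (add_le_add_right
      ((measure_mono (Set.subset_univ E)).trans (hN₂ x hx)) _))
    refine (ENNReal.add_le_add_iff_right (a := δ - δ') (ENNReal.sub_ne_top hδt)).1 ?_
    rwa [add_tsub_cancel_of_le hδ'.le]
  rw [pow_add_apply' _ _ _ _ hA]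
  calc γ * ν B * (c₂⁻¹ * δ') * ProbabilityTheory.cond ν B A
      = γ * (ν B * ProbabilityTheory.cond ν B A) * (c₂⁻¹ * δ') := by ring
    _ = γ * ν (B ∩ A) * (c₂⁻¹ * δ') := by
        rw [mul_comm (ν B), cond_mul_eq_inter hB]
    _ ≤ γ * ν (B ∩ A) * (Q ^ L) x E := by gcongr
    _ ≤ ∫⁻ y, (Q ^ m) y A ∂((Q ^ L) x) := mul_meas_ge_le_lintegral (Kernel.measurable_coe _ hA) _

end Stationary

/-! ### Application to the scaled kernels -/

section Scaled

variable {X : Type*} [MeasurableSpace X]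

theorem MemLinftyW.exists_abs_le {W F : X → ℝ} (hF : MemLinftyW W F) (hW : ∀ x, 1 ≤ W x) :
    ∃ K : ℝ, 0 ≤ K ∧ ∀ x, |F x| ≤ K * W x := by
  obtain ⟨K, hK⟩ := hF.2
  refine ⟨max K 0, le_max_right _ _, fun x => ?_⟩
  have h0 : 0 < W x := zero_lt_one.trans_le (hW x)
  exact (div_le_iff₀ h0).1 ((hK ⟨x, rfl⟩).trans (le_max_left _ _))

/-- Where `W ≤ N`, `|a F| ≤ a₀ K N`. The constant sees `a` only through `a₀`, whence the uniformity
in `a`. -/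
theorem le_smul_expScaledKernel (P : Kernel X X) [IsSFiniteKernel P] {F W : X → ℝ}
    (hF : Measurable F) {K a a₀ : ℝ} (hK : 0 ≤ K) (hFW : ∀ x, |F x| ≤ K * W x)
    (ha : a ∈ Set.Icc (-a₀) a₀) (N : ℕ) (x : X) (hx : W x ≤ N) :
    P x ≤ ((Real.exp (a₀ * (K * N))).toNNReal : ℝ≥0∞) • expScaledKernel P F a x := by
  refine Measure.le_iff.2 fun A _ => ?_
  rw [Measure.smul_apply, smul_eq_mul, expScaledKernel,
    scaledKernel_apply P (hF.const_mul a).exp, ← mul_assoc]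
  refine le_mul_of_one_le_left zero_le ?_
  change 1 ≤ ENNReal.ofReal _ * ENNReal.ofReal _
  rw [← ENNReal.ofReal_mul (Real.exp_pos _).le, ← Real.exp_add, ENNReal.one_le_ofReal,
    Real.one_le_exp_iff]
  have ha' : |a| ≤ a₀ := abs_le.2 ha
  have h1 : |a * F x| ≤ a₀ * (K * N) := by
    rw [abs_mul]
    have h2 : |F x| ≤ K * N := (hFW x).trans (by gcongr)
    gcongr
    exact (abs_nonneg a).trans ha'
  linarith [neg_abs_le (a * F x)]

theorem DriftV3.exists_expScaledKernel_minorization {P : Kernel X X} [IsMarkovKernel P]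
    (hP : IsPositiveHarrisAperiodic P) {V : X → ℝ≥0∞} {W : X → ℝ} {C : Set X} {b : ℝ≥0}
    (hV3 : DriftV3 P V W C b) {F : X → ℝ} (hF : MemLinftyW W F) (a₀ r : ℝ) :
    ∃ (ε₀ : ℝ≥0) (n₀ : ℕ) (ν₀ : Measure X), 0 < ε₀ ∧ 1 ≤ n₀ ∧ IsProbabilityMeasure ν₀ ∧
      ∀ a ∈ Set.Icc (-a₀) a₀, ∀ x ∈ sublevel V r, ∀ A : Set X, MeasurableSet A →
        (ε₀ : ℝ≥0∞) * ν₀ A ≤ (expScaledKernel P F a ^ n₀) x A := by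
  obtain ⟨π, hπp, hπ, hconv⟩ := hP
  by_cases hne : ∃ x, V x ≤ ENNReal.ofReal r
  swap
  -- The sublevel set is empty, so any constants and any probability measure will do.
  · exact ⟨1, 1, π, one_pos, le_rfl, hπp, fun a _ x hx => absurd ⟨x, hx⟩ hne⟩
  obtain ⟨K, hK, hFW⟩ := hF.exists_abs_le hV3.one_le_W
  obtain ⟨ε₀, n₀, ν₀, hε, hn, hν, H⟩ := hV3.exists_minorization hπ hconv
    (fun N => (Real.exp (a₀ * (K * N))).toNNReal) ENNReal.ofReal_lt_top hne
  obtain ⟨ε, hε0, hεε⟩ := ENNReal.lt_iff_exists_nnreal_btwn.1 (pos_iff_ne_zero.2 hε)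
  refine ⟨ε, n₀, ν₀, by exact_mod_cast hε0, hn, hν, fun a ha x hx A hA => ?_⟩
  refine le_trans (by gcongr) (H _ (fun N y hy => ?_) x hx A hA)
  exact le_smul_expScaledKernel P hF.1 hK hFW ha N y hy

end Scaled

end MarkovLDP

theorem proposition2p5 {X : Type*} [MeasurableSpace X] [MeasurableSpace.CountablyGenerated X]
    (P : Kernel X X) [IsMarkovKernel P] (hP : IsPositiveHarrisAperiodic P)
    (V : X → ℝ≥0∞) (W : X → ℝ) (C : Set X) (b : ℝ≥0) (hV3 : DriftV3 P V W C b)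
    (F : X → ℝ) (hF : MemLinftyW W F) :
    (∀ r : ℝ, 1 ≤ r → ∀ a : ℝ, IsSmallSet (expScaledKernel P F a) (sublevel V r)) ∧
    (∀ a₀ : ℝ, 0 < a₀ → ∀ r : ℝ, 1 ≤ r →
      ∃ (ε₀ : ℝ≥0) (n₀ : ℕ) (ν₀ : Measure X), 0 < ε₀ ∧ 1 ≤ n₀ ∧ IsProbabilityMeasure ν₀ ∧
        ∀ a ∈ Set.Icc (-a₀) a₀, ∀ x ∈ sublevel V r, ∀ A : Set X, MeasurableSet A →
          (ε₀ : ℝ≥0∞) * ν₀ A ≤ (expScaledKernel P F a ^ n₀) x A) := by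
  refine ⟨fun r _ a => ?_, fun a₀ _ r _ => hV3.exists_expScaledKernel_minorization hP hF a₀ r⟩
  obtain ⟨ε, n, ν, hε, hn, hν, H⟩ :=
    hV3.exists_expScaledKernel_minorization hP hF |a| r
  have hm : MeasurableSet (sublevel V r) := measurableSet_le hV3.measurable_V measurable_const
  refine ⟨hm, ε, hε, ν, measurable_const.indicator hm, hν, n, hn, fun x A hA => ?_⟩
  by_cases hx : x ∈ sublevel V r
  · simpa [hx] using H a ⟨neg_abs_le a, le_abs_self a⟩ x hx A hA
  · simp [hx]
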